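/- Let $\tau\in i\mathbb{R}_{>0}$, write $q^u=\exp(2\pi i\tau u)$ for $u\in\mathbb{C}$ (so $0<q<1$), and let $(b;p)_\infty=\prod_{j\ge 0}(1-bp^j)$ for $|p|<1$. For $\tau'$ in the upper half plane put \[ \Gamma_{\tau'}(x)=\frac{e^{2\pi i\tau'(-x^2/16)}}{\bigl(-e^{\pi i\tau'(x+1)};e^{2\pi i\tau'}\bigr)_\infty}. \] Let $\lambda\in\mathbb{R}$, $\alpha,\beta\in 2\mathbb{Z}_{>0}$ and $\rho,\sigma\in\mathbb{R}_{\ge 3}$. Define \[ f_\lambda(z;\alpha,\rho)=\frac{\Gamma_{2\tau}\bigl(-1-\frac1{2\tau}+\alpha+\rho-i\lambda+z\bigr)\,\Gamma_{2\tau}\bigl(-\frac1{2\tau}+\rho-i\lambda-z\bigr)}{\Gamma_{2\tau}\bigl(1-\frac1{2\tau}+\alpha+\rho+i\lambda-z\bigr)\,\Gamma_{2\tau}\bigl(-\frac1{2\tau}+\rho+i\lambda+z\bigr)}, \] and for $|\mathrm{Re}(x)|\le 2$ \[ \phi_\lambda(x)=\int_0^1 f_\lambda\bigl(1+x+\tfrac{y}{\tau};\beta,\sigma\bigr)\,\overline{f_\lambda\bigl(\tfrac{y}{\tau};\alpha,\rho\bigr)}\,dy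 . \] Put $(a,b,c,d)=(1+\rho+\sigma,\;1-\rho+\sigma,\;1+\alpha+\rho-\beta-\sigma,\;1-\alpha-\rho-\beta-\sigma)$, \[ \Delta(x)=\frac{\Gamma_{2\tau}\bigl(-1+\frac1{2\tau}+a-x\bigr)\,\Gamma_{2\tau}\bigl(-1+\frac1{2\tau}+b-x\bigr)}{\Gamma_{2\tau}\bigl(1+\frac1{2\tau}-c-x\bigr)\,\Gamma_{2\tau}\bigl(1+\frac1{2\tau}-d-x\bigr)}, \qquad F_\lambda(x)=\Delta(x)^{-1}\phi_\lambda(x), \] \[ E(\lambda)=-1-q^{2-2\beta}+q^{1-\beta}\bigl(q^{2i\lambda}+q^{-2i\lambda}\bigr), \] and let $\mathcal{D}$ be the Askey--Wilson second order difference operator \[ (\mathcal{D}f)(x)=A(x)\bigl(f(x+2)-f(x)\bigr)+A(-x)\bigl(f(x-2)-f(x)\bigr),\qquad A(x)=\frac{(1-q^{a+x})(1-q^{b+x})(1-q^{c+x})(1-q^{d+x})}{(1-q^{2x})(1-q^{2+2x})}. \] Then $\Delta$ is a $\tau^{-1}$-periodic meromorphic function on $\mathbb{C}$, the integral defining $\phi_\lambda(x)$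 converges for $|\mathrm{Re}(x)|\le 2$, and for every $x\in i\mathbb{R}$ with $q^{2x}\neq 1$ (hence for generic $x\in i\mathbb{R}$) the function $\Delta$ is analytic and nonzero at $x$ and $x\pm 2$, and \[ (\mathcal{D}F_\lambda)(x)=E(\lambda)\,F_\lambda(x). \] -/

import Mathlib

open scoped ComplexConjugate

namespace AskeyWilson

noncomputable section

/-- The power `q ^ u = exp (2 π i τ u)` of the deformation parameter `q = exp (2 π i τ)`. -/
def qpow (τ u : ℂ) : ℂ := Complex.exp (2 * Real.pi * Complex.I * τ * u)

/-- The infinite `q`-shifted factorial `(b; p)_∞ = ∏_{j ≥ 0} (1 - b p ^ j)`, for `|p| < 1`. -/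
def qPochInf (b p : ℂ) : ℂ := ∏' j : ℕ, (1 - b * p ^ j)

/-- The `q`-gamma type function
`Γ_τ(x) = q ^ (- x ^ 2 / 16) / (- q ^ ((x + 1) / 2); q)_∞` for `τ` in the upper half plane.
It is meromorphic and zero-free; at its poles the formula below takes the value `0`. -/
def qGamma (τ x : ℂ) : ℂ :=
  qpow τ (-(x ^ 2) / 16) / qPochInf (-qpow τ ((x + 1) / 2)) (qpow τ 1)

/-- The function `f_λ(z; α, ρ)`. -/
def eigenf (τ lam α ρ z : ℂ) : ℂ :=
  (qGamma (2 * τ) (-1 - 1 / (2 * τ) + α + ρ - Complex.I * lam + z) *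
      qGamma (2 * τ) (-(1 / (2 * τ)) + ρ - Complex.I * lam - z)) /
    (qGamma (2 * τ) (1 - 1 / (2 * τ) + α + ρ + Complex.I * lam - z) *
      qGamma (2 * τ) (-(1 / (2 * τ)) + ρ + Complex.I * lam + z))

/-- The action of the generator `K` in the representation `π_λ` (it does not depend on `λ`). -/
def actK (f : ℂ → ℂ) : ℂ → ℂ := fun z => f (z + 1)

/-- The action of the group-like element attached to `x ∈ ℂ` in the representation `π_λ`. -/
def actHat (x : ℂ) (f : ℂ → ℂ) : ℂ → ℂ := fun z => f (z + x)

/-- The integrand of the pairing, `y ↦ f (y / τ) * conj (g (y / τ))`. -/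
def pairingIntegrand (τ : ℂ) (f g : ℂ → ℂ) (y : ℝ) : ℂ := f (y / τ) * conj (g (y / τ))

/-- The pairing `⟨f, g⟩ = ∫_0^1 f (y / τ) conj (g (y / τ)) dy`. -/
def pairing (τ : ℂ) (f g : ℂ → ℂ) : ℂ := ∫ y in (0 : ℝ)..1, pairingIntegrand τ f g y

/-- The matrix coefficient `φ_λ(x; α, ρ, β, σ) = ⟨π_λ(x̂ K) f_λ(·; β, σ), f_λ(·; α, ρ)⟩`;
it is only used for `|Re x| ≤ 2`. -/
def phi (τ lam α ρ β σ x : ℂ) : ℂ :=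
  pairing τ (actHat x (actK (eigenf τ lam β σ))) (eigenf τ lam α ρ)

/-- The coefficient `A(x; a, b, c, d)` of the Askey-Wilson operator (in base `q ^ 2`). -/
def coeffA (τ a b c d x : ℂ) : ℂ :=
  ((1 - qpow τ (a + x)) * (1 - qpow τ (b + x)) * (1 - qpow τ (c + x)) * (1 - qpow τ (d + x))) /
    ((1 - qpow τ (2 * x)) * (1 - qpow τ (2 + 2 * x)))

/-- The Askey-Wilson second order difference operator `𝒟 = 𝒟^{a,b,c,d}`. -/
def opD (τ a b c d : ℂ) (f : ℂ → ℂ) (x : ℂ) : ℂ :=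
  coeffA τ a b c d x * (f (x + 2) - f x) + coeffA τ a b c d (-x) * (f (x - 2) - f x)

/-- The eigenvalue `E(λ; β) = -1 - q ^ (2 - 2 β) + q ^ (1 - β) (q ^ (2 i λ) + q ^ (-2 i λ))`. -/
def eigenvalE (τ lam β : ℂ) : ℂ :=
  -1 - qpow τ (2 - 2 * β) +
    qpow τ (1 - β) * (qpow τ (2 * Complex.I * lam) + qpow τ (-(2 * Complex.I * lam)))

/-- The gauge factor `Δ(x; a, b, c, d)`. -/
def gaugeΔ (τ a b c d x : ℂ) : ℂ :=
  (qGamma (2 * τ) (-1 + 1 / (2 * τ) + a - x) * qGamma (2 * τ) (-1 + 1 / (2 * τ) + b - x)) /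
    (qGamma (2 * τ) (1 + 1 / (2 * τ) - c - x) * qGamma (2 * τ) (1 + 1 / (2 * τ) - d - x))

end

end AskeyWilson

/-! Every quotient of q-gamma functions here is, up to a constant and an exponential, a quotient of
products `(q ^ w; q ^ 2)_∞`: the half period `1 / (2τ)` absorbs the sign inside `Γ`, and the
quadratic terms of the Gaussian factors cancel. On the imaginary axis `conj z = -z`, so the
conjugated factor extends to a meromorphic function of `z`, and `φ_λ(x)` becomes a constant times an
integral over one period of a meromorphic integrand `I_x(z)`.

The shifts `x ↦ x ± 2` multiply `I_x(z)` by rational functions of `X = q ^ x` and `u = q ^ z`. By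
creative telescoping, a combination of `I_{x+2}`, `I_x`, `I_{x-2}` with coefficients independent of
`z` equals `G(z + 2) - G(z)` (`coreIntegrand_telescope`); after removal of common factors this is
the rational identity `certificate_identity`. Since `α` and `β` are even, `G` is `τ⁻¹`-periodic, and
since `ρ, σ ≥ 3` its poles stay out of the strip `0 ≤ Re z ≤ 2`. Cauchy's theorem
(`integral_add_eq_of_periodic`) then makes the integral of the difference vanish, which is a
three-term equation for `φ_λ` (`integral_coreIntegrand_recurrence`).

The gauge factor satisfies a first order equation (`gaugeCore_add_two`) whose multiplier turns the
outer coefficients into `A(x)` and `A(-x)` (`upCoeff_mul_eq`, `downCoeff_mul_eq`); the middle one is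
already `-(A(x) + A(-x) + E(λ))` after clearing denominators (`midCoeff_eq`). -/

namespace AskeyWilson

/-! ### Powers of `q` -/

section QPow

lemma qpow_add (τ u v : ℂ) : qpow τ (u + v) = qpow τ u * qpow τ v := by
  simp only [qpow, mul_add, Complex.exp_add]

lemma qpow_neg (τ u : ℂ) : qpow τ (-u) = (qpow τ u)⁻¹ := by
  simp only [qpow, mul_neg, Complex.exp_neg]

lemma qpow_sub (τ u v : ℂ) : qpow τ (u - v) = qpow τ u / qpow τ v := by
  rw [sub_eq_add_neg, qpow_add, qpow_neg, div_eq_mul_inv]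

lemma qpow_ne_zero (τ u : ℂ) : qpow τ u ≠ 0 := Complex.exp_ne_zero _

lemma qpow_nat_mul (τ u : ℂ) (n : ℕ) : qpow τ (n * u) = qpow τ u ^ n := by
  rw [qpow, qpow, ← Complex.exp_nat_mul]; ring_nf

lemma qpow_ofNat_mul (τ u : ℂ) (n : ℕ) [n.AtLeastTwo] :
    qpow τ (ofNat(n) * u) = qpow τ u ^ (ofNat(n) : ℕ) := qpow_nat_mul τ u n

lemma qpow_two (τ : ℂ) : qpow τ 2 = qpow τ 1 ^ 2 := by
  rw [← qpow_nat_mul]; norm_num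

lemma qpow_two_mul_left (τ u : ℂ) : qpow (2 * τ) u = qpow τ (2 * u) := by
  simp only [qpow]; ring_nf

lemma qpow_half_inv {τ : ℂ} (hτ : τ ≠ 0) : qpow τ (1 / (2 * τ)) = -1 := by
  rw [qpow, ← Complex.exp_pi_mul_I]
  congr 1
  field_simp

lemma qpow_nat_mul_inv {τ : ℂ} (hτ : τ ≠ 0) (n : ℕ) : qpow τ (n * τ⁻¹) = 1 := by
  rw [qpow, Complex.exp_eq_one_iff]
  exact ⟨n, by field_simp; simp⟩

lemma qpow_inv {τ : ℂ} (hτ : τ ≠ 0) : qpow τ τ⁻¹ = 1 := by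
  simpa using qpow_nat_mul_inv hτ 1

lemma qpow_add_inv {τ : ℂ} (hτ : τ ≠ 0) (u : ℂ) : qpow τ (u + τ⁻¹) = qpow τ u := by
  rw [qpow_add, qpow_inv hτ, mul_one]

lemma qpow_sub_inv {τ : ℂ} (hτ : τ ≠ 0) (u : ℂ) : qpow τ (u - τ⁻¹) = qpow τ u := by
  rw [qpow_sub, qpow_inv hτ, div_one]

lemma differentiable_qpow (τ : ℂ) : Differentiable ℂ (qpow τ) := by
  unfold qpow; fun_prop

lemma norm_qpow {τ : ℂ} (hτre : τ.re = 0) (u : ℂ) :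
    ‖qpow τ u‖ = Real.exp (-(2 * Real.pi * τ.im) * u.re) := by
  rw [qpow, Complex.norm_exp]
  congr 1
  simp [hτre]

lemma norm_qpow_lt_one {τ : ℂ} (hτre : τ.re = 0) (hτim : 0 < τ.im) {u : ℂ} (hu : 0 < u.re) :
    ‖qpow τ u‖ < 1 := by
  rw [norm_qpow hτre, Real.exp_lt_one_iff]
  have := mul_pos (mul_pos Real.two_pi_pos hτim) hu
  linarith

lemma qpow_ne_one_of_re_pos {τ : ℂ} (hτre : τ.re = 0) (hτim : 0 < τ.im) {u : ℂ} (hu : 0 < u.re) :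
    qpow τ u ≠ 1 := fun h => by
  have := norm_qpow_lt_one hτre hτim hu
  simp [h] at this

lemma re_eq_zero_of_qpow_eq_one {τ : ℂ} (hτre : τ.re = 0) (hτim : 0 < τ.im) {u : ℂ}
    (hu : qpow τ u = 1) : u.re = 0 := by
  have h := norm_qpow hτre u
  rw [hu, norm_one, eq_comm, Real.exp_eq_one_iff] at h
  have : -(2 * Real.pi * τ.im) ≠ 0 := neg_ne_zero.2 (mul_pos Real.two_pi_pos hτim).ne'
  exact (mul_eq_zero.1 h).resolve_left this

lemma conj_qpow {τ : ℂ} (hτre : τ.re = 0) (u : ℂ) : conj (qpow τ u) = qpow τ (conj u) := by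
  have h : conj τ = -τ := by apply Complex.ext <;> simp [hτre]
  rw [qpow, qpow, ← Complex.exp_conj]
  congr 1
  simp only [map_mul, map_ofNat, Complex.conj_ofReal, Complex.conj_I, h]
  ring

end QPow

/-! ### Infinite q-shifted factorials -/

section QPoch

variable {p : ℂ}

lemma multipliable_one_sub_mul_pow (hp : ‖p‖ < 1) (b : ℂ) :
    Multipliable fun j : ℕ => 1 - b * p ^ j := by
  simp_rw [sub_eq_add_neg]
  refine multipliable_one_add_of_summable ?_
  simpa using (summable_geometric_of_lt_one (norm_nonneg _) hp).mul_left ‖b‖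

lemma qPochInf_eq_mul (hp : ‖p‖ < 1) (b : ℂ) : qPochInf b p = (1 - b) * qPochInf (b * p) p := by
  unfold qPochInf
  have h : (fun j : ℕ => 1 - b * p * p ^ j) = fun j : ℕ => 1 - b * p ^ (j + 1) := by
    ext j; ring
  rw [h, tprod_eq_zero_mul']
  · simp
  · rw [← h]; exact multipliable_one_sub_mul_pow hp _

lemma qPochInf_ne_zero (hp : ‖p‖ < 1) {b : ℂ} (hb : ∀ j : ℕ, b * p ^ j ≠ 1) :
    qPochInf b p ≠ 0 := by
  unfold qPochInf
  simp_rw [sub_eq_add_neg]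
  refine tprod_one_add_ne_zero_of_summable (fun j h => hb j ?_) ?_
  · linear_combination -h
  · simpa using (summable_geometric_of_lt_one (norm_nonneg _) hp).mul_left ‖b‖

/-- On a ball around `0` containing the given point, the geometric series `(‖b₀‖ + 1) ‖p‖ ^ j`
dominates, so the product converges locally uniformly. -/
lemma differentiable_qPochInf (hp : ‖p‖ < 1) : Differentiable ℂ fun b => qPochInf b p := by
  intro b₀
  have h : MultipliableLocallyUniformlyOn (fun (j : ℕ) b => 1 - b * p ^ j)
      (Metric.ball (0 : ℂ) (‖b₀‖ + 1)) := by
    simp_rw [sub_eq_add_neg]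
    refine Summable.multipliableLocallyUniformlyOn_nat_one_add Metric.isOpen_ball
      ((summable_geometric_of_lt_one (norm_nonneg _) hp).mul_left (‖b₀‖ + 1))
      (.of_forall fun n b hb => ?_) (fun _ => by fun_prop)
    rw [mem_ball_zero_iff] at hb
    rw [norm_neg, norm_mul, norm_pow]
    gcongr
  have h' : DifferentiableOn ℂ (fun b => qPochInf b p) (Metric.ball (0 : ℂ) (‖b₀‖ + 1)) :=
    h.hasProdLocallyUniformlyOn.differentiableOn
      (.of_forall fun _ => by simpa [Finset.prod_fn] using
        DifferentiableOn.finsetProd (fun _ _ => by fun_prop)) Metric.isOpen_ball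
  exact h'.differentiableAt (Metric.isOpen_ball.mem_nhds (by simp))

lemma conj_qPochInf (b p : ℂ) : conj (qPochInf b p) = qPochInf (conj b) (conj p) := by
  unfold qPochInf
  have h : Function.LeftInverse (conj : ℂ → ℂ) conj := Complex.conj_conj
  rw [Function.LeftInverse.map_tprod (g := starRingEnd ℂ) (g' := starRingEnd ℂ)
    _ Complex.continuous_conj Complex.continuous_conj h]
  simp

end QPoch

/-! ### Shifted factorials in the exponent variable, and their relation to `Γ` -/

/-- The `q`-shifted factorial `(q ^ w; q ^ 2)_∞` as a function of the exponent `w`. -/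
noncomputable def expPoch (τ w : ℂ) : ℂ := qPochInf (qpow τ w) (qpow τ 2)

section ExpPoch

variable {τ : ℂ}

lemma expPoch_eq_mul (hτre : τ.re = 0) (hτim : 0 < τ.im) (w : ℂ) :
    expPoch τ w = (1 - qpow τ w) * expPoch τ (w + 2) := by
  rw [expPoch, qPochInf_eq_mul (norm_qpow_lt_one hτre hτim (by simp)), expPoch, qpow_add]

lemma expPoch_ne_zero (hτre : τ.re = 0) (hτim : 0 < τ.im) {w : ℂ}
    (hw : ∀ j : ℕ, qpow τ (w + 2 * j) ≠ 1) : expPoch τ w ≠ 0 := by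
  refine qPochInf_ne_zero (norm_qpow_lt_one hτre hτim (by simp)) fun j => ?_
  rw [← qpow_nat_mul, ← qpow_add, mul_comm (j : ℂ)]
  exact hw j

lemma expPoch_ne_zero_of_re_pos (hτre : τ.re = 0) (hτim : 0 < τ.im) {w : ℂ} (hw : 0 < w.re) :
    expPoch τ w ≠ 0 := by
  refine expPoch_ne_zero hτre hτim fun j => qpow_ne_one_of_re_pos hτre hτim ?_
  simp
  positivity

lemma differentiable_expPoch (hτre : τ.re = 0) (hτim : 0 < τ.im) :
    Differentiable ℂ (expPoch τ) :=
  (differentiable_qPochInf (norm_qpow_lt_one hτre hτim (by simp))).comp (differentiable_qpow τ)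

lemma expPoch_add_inv (hτ : τ ≠ 0) (w : ℂ) : expPoch τ (w + τ⁻¹) = expPoch τ w := by
  rw [expPoch, qpow_add_inv hτ, expPoch]

lemma expPoch_sub_inv (hτ : τ ≠ 0) (w : ℂ) : expPoch τ (w - τ⁻¹) = expPoch τ w := by
  rw [expPoch, qpow_sub_inv hτ, expPoch]

lemma conj_expPoch (hτre : τ.re = 0) (w : ℂ) : conj (expPoch τ w) = expPoch τ (conj w) := by
  rw [expPoch, conj_qPochInf, conj_qpow hτre, conj_qpow hτre, expPoch, map_ofNat]

/-- Since `q ^ (1 / (2τ)) = -1`, the half period cancels the minus sign in the denominator of `Γ`.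
-/
lemma qGamma_add_half_period (hτ : τ ≠ 0) (w : ℂ) :
    qGamma (2 * τ) (w + 1 / (2 * τ)) =
      qpow τ (-((w + 1 / (2 * τ)) ^ 2) / 8) / expPoch τ (w + 1) := by
  rw [qGamma, expPoch, qpow_two_mul_left, qpow_two_mul_left, qpow_two_mul_left]
  congr 2
  · ring
  · rw [show 2 * ((w + 1 / (2 * τ) + 1) / 2) = w + 1 + 1 / (2 * τ) by ring, qpow_add,
      qpow_half_inv hτ]
    ring
  · norm_num

lemma qGamma_sub_half_period (hτ : τ ≠ 0) (w : ℂ) :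
    qGamma (2 * τ) (w - 1 / (2 * τ)) =
      qpow τ (-((w - 1 / (2 * τ)) ^ 2) / 8) / expPoch τ (w + 1) := by
  rw [qGamma, expPoch, qpow_two_mul_left, qpow_two_mul_left, qpow_two_mul_left]
  congr 2
  · ring
  · rw [show 2 * ((w - 1 / (2 * τ) + 1) / 2) = w + 1 - 1 / (2 * τ) by ring, qpow_sub,
      qpow_half_inv hτ]
    ring
  · norm_num

end ExpPoch

/-! ### The rational identity behind the telescoping -/

section Certificate

/-- The coefficient of `φ(x + 2)` in the second order difference equation of `φ`, multiplied by
`(1 - X ^ 2) (1 - q ^ 2 X ^ 2) (X ^ 2 - q ^ 2)`. -/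
noncomputable def upCoeff (q B S X a b : ℂ) : ℂ :=
  q ^ 2 / (B * S ^ 2) * X ^ 2 * (1 - a * X) * (1 - b * X) * (1 - a / (X * q ^ 2)) *
    (1 - b / (X * q ^ 2)) * (X ^ 2 - q ^ 2)

/-- The coefficient of `φ(x - 2)` in the second order difference equation of `φ`, multiplied by
`(1 - X ^ 2) (1 - q ^ 2 X ^ 2) (X ^ 2 - q ^ 2)`. -/
noncomputable def downCoeff (q B X c d : ℂ) : ℂ :=
  -B⁻¹ * (1 - c / X) * (1 - d / X) * (1 - q ^ 2 / (c * X)) * (1 - q ^ 2 / (d * X)) *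
    (X ^ 4 * (1 - q ^ 2 * X ^ 2))

/-- The coefficient of `φ(x)` in the second order difference equation of `φ`, multiplied by
`(1 - X ^ 2) (1 - q ^ 2 X ^ 2) (X ^ 2 - q ^ 2)`. -/
noncomputable def midCoeff (q L B X a b c d : ℂ) : ℂ :=
  -((1 - a * X) * (1 - b * X) * (1 - c * X) * (1 - d * X) * (X ^ 2 - q ^ 2) -
    X ^ 4 * (1 - q ^ 2 * X ^ 2) * (1 - a / X) * (1 - b / X) * (1 - c / X) * (1 - d / X) +
    (-1 - q ^ 2 / B ^ 2 + q / B * (L ^ 2 + 1 / L ^ 2)) *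
      ((1 - X ^ 2) * (1 - q ^ 2 * X ^ 2) * (X ^ 2 - q ^ 2)))

/-- The certificate of the telescoping identity, a Laurent polynomial in `w`. -/
noncomputable def certificate (q L B S A R X w : ℂ) : ℂ :=
  X ^ 2 * ((X ^ 2 - q ^ 2) * (q / (L * A)) * (q * (1 + S ^ 2) * X / R - S * (1 + 1 / R ^ 2)) +
      (1 - q ^ 2 * X ^ 2) * (q * L) *
        ((1 / B + B * S ^ 2) * X / (A * R) - q * S * (1 + 1 / (A * R) ^ 2))) * (X * w) +
    (S * X / (A * R) * (1 / L ^ 2 - q ^ 2 * L ^ 2) * (X ^ 2 - q ^ 2) * (1 - q ^ 2 * X ^ 2) -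
      q * (1 - q ^ 4) * X ^ 3 / (A * R * S) * (1 + S ^ 2) * (1 / B + B * S ^ 2) +
      q ^ 2 * X ^ 2 / A * (1 + 1 / R ^ 2) * (1 / B + B * S ^ 2) * (X ^ 2 - q ^ 2) +
      q ^ 2 * X ^ 2 * (1 + 1 / (A * R) ^ 2) * (1 + S ^ 2) * (1 - q ^ 2 * X ^ 2)) +
    q ^ 2 * X * ((1 - q ^ 2 * X ^ 2) / L *
        (q / (A * R) * (1 / B + B * S ^ 2) - S * (1 + 1 / (A * R) ^ 2) * X) +
      L * (X ^ 2 - q ^ 2) * ((1 + S ^ 2) / (A * R) - q * S * X / A * (1 + 1 / R ^ 2))) *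
      (X * w)⁻¹

set_option maxHeartbeats 4000000 in
-- The telescoping identity divided by the common factors `eigenfBase` and `eigenfDual`. Dictionary:
-- `L = q ^ (iλ)`, `B = q ^ β`, `S = q ^ σ`, `A = q ^ α`, `R = q ^ ρ`, `X = q ^ x`, `u = q ^ z`;
-- hence `q * X * u = q ^ (1 + x + z)`, and `z ↦ z + 2` is `u ↦ q ^ 2 * u`.
theorem certificate_identity {q L B S A R X u : ℂ} (hq : q ≠ 0) (hL : L ≠ 0) (hB : B ≠ 0)
    (hS : S ≠ 0) (hA : A ≠ 0) (hR : R ≠ 0) (hX : X ≠ 0) (hu : u ≠ 0) :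
    upCoeff q B S X (q * R * S) (q * S / R) * B⁻¹ *
        ((1 - B * S * L / (q * X * u)) * (1 - B * S * (q * X * u) / L) *
          ((1 - B * S * q ^ 2 * L / (q * X * u)) * (1 - B * S * (q * X * u) / (q ^ 2 * L)))) +
      midCoeff q L B X (q * R * S) (q * S / R) (q * A * R / (B * S)) (q / (A * R * B * S)) *
        ((1 - q * S * L * (q * X * u)) * (1 - S / (q * L * (q * X * u))) *
          ((1 - B * S * q ^ 2 * L / (q * X * u)) * (1 - B * S * (q * X * u) / (q ^ 2 * L)))) +
      downCoeff q B X (q * A * R / (B * S)) (q / (A * R * B * S)) * B *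
        ((1 - S * L * (q * X * u) / q) * (1 - q * S / (L * (q * X * u))) *
          ((1 - q * S * L * (q * X * u)) * (1 - S / (q * L * (q * X * u))))) =
    certificate q L B S A R X (q ^ 2 * u) * (A / B) *
        ((1 - R / (q * L * u)) * (1 - q * R * L * u)) *
        ((1 - B * S * q ^ 2 * L / (q * X * u)) * (1 - B * S * (q * X * u) / (q ^ 2 * L))) -
      certificate q L B S A R X u * ((1 - A * R * u / L) * (1 - A * R * L / u)) *
        ((1 - q * S * L * (q * X * u)) * (1 - S / (q * L * (q * X * u)))) := by
  simp only [upCoeff, midCoeff, downCoeff, certificate]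
  field_simp
  ring

end Certificate

/-! ### Blocks: shifts, contiguity, regularity and periodicity -/

/-- The function `q ^ (κ z) (q ^ (p₁ - z), q ^ (p₂ + z); q ^ 2)_∞ /
(q ^ (p₃ + z), q ^ (p₄ - z); q ^ 2)_∞`. -/
noncomputable def block (τ κ p₁ p₂ p₃ p₄ z : ℂ) : ℂ :=
  qpow τ (κ * z) * (expPoch τ (p₁ - z) * expPoch τ (p₂ + z)) /
    (expPoch τ (p₃ + z) * expPoch τ (p₄ - z))

section Block

variable {τ : ℂ}

lemma block_add_two (κ p₁ p₂ p₃ p₄ z : ℂ) :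
    block τ κ p₁ p₂ p₃ p₄ (z + 2) =
      qpow τ (2 * κ) * block τ κ (p₁ - 2) (p₂ + 2) (p₃ + 2) (p₄ - 2) z := by
  simp only [block]
  rw [show κ * (z + 2) = 2 * κ + κ * z by ring, qpow_add, show p₁ - (z + 2) = p₁ - 2 - z by ring,
    show p₂ + (z + 2) = p₂ + 2 + z by ring, show p₃ + (z + 2) = p₃ + 2 + z by ring,
    show p₄ - (z + 2) = p₄ - 2 - z by ring]
  ring

lemma block_sub_two (κ p₁ p₂ p₃ p₄ z : ℂ) :
    block τ κ p₁ p₂ p₃ p₄ (z - 2) =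
      qpow τ (-(2 * κ)) * block τ κ (p₁ + 2) (p₂ - 2) (p₃ - 2) (p₄ + 2) z := by
  simp only [block]
  rw [show κ * (z - 2) = -(2 * κ) + κ * z by ring, qpow_add,
    show p₁ - (z - 2) = p₁ + 2 - z by ring,
    show p₂ + (z - 2) = p₂ - 2 + z by ring, show p₃ + (z - 2) = p₃ - 2 + z by ring,
    show p₄ - (z - 2) = p₄ + 2 - z by ring]
  ring

lemma block_raise₁ (hτre : τ.re = 0) (hτim : 0 < τ.im) (κ p₁ p₂ p₃ p₄ z : ℂ) :
    block τ κ p₁ p₂ p₃ p₄ z =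
      (1 - qpow τ (p₁ - z)) * block τ κ (p₁ + 2) p₂ p₃ p₄ z := by
  simp only [block]
  rw [expPoch_eq_mul hτre hτim (p₁ - z), show p₁ - z + 2 = p₁ + 2 - z by ring]
  ring

lemma block_raise₂ (hτre : τ.re = 0) (hτim : 0 < τ.im) (κ p₁ p₂ p₃ p₄ z : ℂ) :
    block τ κ p₁ p₂ p₃ p₄ z =
      (1 - qpow τ (p₂ + z)) * block τ κ p₁ (p₂ + 2) p₃ p₄ z := by
  simp only [block]
  rw [expPoch_eq_mul hτre hτim (p₂ + z), show p₂ + z + 2 = p₂ + 2 + z by ring]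
  ring

/-- The bound on the real part gives `|q ^ (p₃ - 2 + z)| < 1`, so the factor cancelled from the
denominator is nonzero. -/
lemma block_lower₃ (hτre : τ.re = 0) (hτim : 0 < τ.im) (κ p₁ p₂ p₄ : ℂ) {p₃ z : ℂ}
    (h : 2 < (p₃ + z).re) :
    block τ κ p₁ p₂ p₃ p₄ z =
      (1 - qpow τ (p₃ - 2 + z)) * block τ κ p₁ p₂ (p₃ - 2) p₄ z := by
  have h1 : 1 - qpow τ (p₃ - 2 + z) ≠ 0 := sub_ne_zero.2
    (qpow_ne_one_of_re_pos hτre hτim (by simp at h ⊢; linarith)).symm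
  simp only [block]
  rw [expPoch_eq_mul hτre hτim (p₃ - 2 + z), show p₃ - 2 + z + 2 = p₃ + z by ring,
    mul_assoc (1 - qpow τ (p₃ - 2 + z)), ← mul_div_assoc, mul_div_mul_left _ _ h1]

lemma block_lower₄ (hτre : τ.re = 0) (hτim : 0 < τ.im) (κ p₁ p₂ p₃ : ℂ) {p₄ z : ℂ}
    (h : 2 < (p₄ - z).re) :
    block τ κ p₁ p₂ p₃ p₄ z =
      (1 - qpow τ (p₄ - 2 - z)) * block τ κ p₁ p₂ p₃ (p₄ - 2) z := by
  have h1 : 1 - qpow τ (p₄ - 2 - z) ≠ 0 := sub_ne_zero.2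
    (qpow_ne_one_of_re_pos hτre hτim (by simp at h ⊢; linarith)).symm
  simp only [block]
  rw [expPoch_eq_mul hτre hτim (p₄ - 2 - z), show p₄ - 2 - z + 2 = p₄ - z by ring,
    mul_left_comm (expPoch τ (p₃ + z)), ← mul_div_assoc, mul_div_mul_left _ _ h1]

lemma block_differentiableAt (hτre : τ.re = 0) (hτim : 0 < τ.im) (κ p₁ p₂ : ℂ) {p₃ p₄ z : ℂ}
    (h₃ : 0 < (p₃ + z).re) (h₄ : 0 < (p₄ - z).re) :
    DifferentiableAt ℂ (block τ κ p₁ p₂ p₃ p₄) z := by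
  have hΦ := differentiable_expPoch hτre hτim
  have hq := differentiable_qpow τ
  have h₃' := expPoch_ne_zero_of_re_pos hτre hτim h₃
  have h₄' := expPoch_ne_zero_of_re_pos hτre hτim h₄
  unfold block
  refine DifferentiableAt.div ?_ ?_ (mul_ne_zero h₃' h₄')
  · fun_prop
  · fun_prop

/-- The infinite products depend on `z` only through `q ^ z`, which has period `τ⁻¹`; the prefactor
`q ^ (κ z)` shares this period because evenness of `n` makes `κ` an integer. -/
lemma block_add_inv (hτ : τ ≠ 0) (n : ℕ) (hn : Even n) (κ p₁ p₂ p₃ p₄ z : ℂ)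
    (hκ : κ = n / 2 ∨ κ = -(n / 2)) :
    block τ κ p₁ p₂ p₃ p₄ (z + τ⁻¹) = block τ κ p₁ p₂ p₃ p₄ z := by
  have h : qpow τ (κ * (z + τ⁻¹)) = qpow τ (κ * z) := by
    obtain ⟨k, rfl⟩ := hn
    rw [mul_add, qpow_add]
    rcases hκ with rfl | rfl
    · rw [show (((k + k : ℕ) : ℂ) / 2) * τ⁻¹ = k * τ⁻¹ by push_cast; ring,
        qpow_nat_mul_inv hτ, mul_one]
    · rw [show -(((k + k : ℕ) : ℂ) / 2) * τ⁻¹ = -(k * τ⁻¹) by push_cast; ring, qpow_neg,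
        qpow_nat_mul_inv hτ, inv_one, mul_one]
  simp only [block]
  rw [h, ← sub_sub, ← sub_sub, ← add_assoc, ← add_assoc, expPoch_sub_inv hτ, expPoch_sub_inv hτ,
    expPoch_add_inv hτ, expPoch_add_inv hτ]

end Block

/-! ### Contour shift -/

/-- Shifting the contour of integration of a periodic function that is holomorphic on a strip. -/
theorem integral_add_eq_of_periodic {τ : ℂ} (hτre : τ.re = 0) (hτim : 0 < τ.im) {G : ℂ → ℂ}
    {r : ℝ} (hr : 0 ≤ r) (hd : ∀ z : ℂ, 0 ≤ z.re → z.re ≤ r → DifferentiableAt ℂ G z)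
    (hper : ∀ z, G (z + τ⁻¹) = G z) :
    ∫ y in (0 : ℝ)..1, G (y / τ + r) = ∫ y in (0 : ℝ)..1, G (y / τ) := by
  obtain ⟨t, ht, rfl⟩ : ∃ t : ℝ, 0 < t ∧ τ = t * Complex.I :=
    ⟨τ.im, hτim, by apply Complex.ext <;> simp [hτre]⟩
  have htc : (t : ℂ) ≠ 0 := by exact_mod_cast ht.ne'
  have hinv : ((t : ℂ) * Complex.I)⁻¹ = ((-t⁻¹ : ℝ) : ℂ) * Complex.I := by
    rw [mul_inv, Complex.inv_I]; push_cast; ring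
  -- The rectangle has opposite corners `0` and `r + τ⁻¹`; as `τ = it`, its height is one period,
  -- directed downwards.
  have hrect := Complex.integral_boundary_rect_eq_zero_of_differentiableOn G 0
    (r + ((-t⁻¹ : ℝ) : ℂ) * Complex.I) (fun z hz => by
      rw [Complex.mem_reProdIm] at hz
      have h1 := hz.1
      simp [Set.uIcc_of_le hr] at h1
      exact (hd z h1.1 h1.2).differentiableWithinAt)
  have hline : ∀ c : ℂ, ∫ y in (0 : ℝ)..(-t⁻¹), G (c + y * Complex.I) =
      (-t⁻¹ : ℝ) * ∫ y in (0 : ℝ)..1, G (y / (t * Complex.I) + c) := by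
    intro c
    have h := intervalIntegral.smul_integral_comp_mul_left (a := 0) (b := 1)
      (fun y : ℝ => G (c + y * Complex.I)) (-t⁻¹)
    rw [mul_zero, mul_one] at h
    rw [← h, Complex.real_smul]
    congr 1
    refine intervalIntegral.integral_congr fun y _ => ?_
    rw [div_eq_mul_inv (y : ℂ), hinv]
    congr 1
    push_cast
    ring
  have him : ((r : ℂ) + ((-t⁻¹ : ℝ) : ℂ) * Complex.I).im = -t⁻¹ := by simp
  have hre : ((r : ℂ) + ((-t⁻¹ : ℝ) : ℂ) * Complex.I).re = r := by simp
  rw [him, hre, Complex.zero_re, Complex.zero_im, hline, hline] at hrect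
  -- The horizontal sides differ by the period `τ⁻¹`, so their contributions cancel.
  have hhor : ∫ x in (0 : ℝ)..r, G (x + ((-t⁻¹ : ℝ) : ℂ) * Complex.I) =
      ∫ x in (0 : ℝ)..r, G (x + ((0 : ℝ) : ℂ) * Complex.I) := by
    refine intervalIntegral.integral_congr fun x _ => ?_
    rw [← hinv, hper]
    simp
  rw [hhor, sub_self, zero_add, ← smul_sub, ← mul_sub, smul_eq_mul, mul_eq_zero, mul_eq_zero,
    sub_eq_zero] at hrect
  have ht' : ((-t⁻¹ : ℝ) : ℂ) ≠ 0 := by simpa using ht.ne'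
  simpa using (hrect.resolve_left Complex.I_ne_zero).resolve_left ht'

/-! ### Reduction of `f_λ` and of the pairing integrand to blocks -/

/-- The function `f_λ(z; α, ρ)` without its constant factor. -/
noncomputable def eigenfCore (τ lam α ρ : ℂ) : ℂ → ℂ :=
  block τ (-(α / 2)) (2 + α + ρ + Complex.I * lam) (1 + ρ + Complex.I * lam)
    (α + ρ - Complex.I * lam) (1 + ρ - Complex.I * lam)

/-- The conjugate of `eigenfCore` on the imaginary axis. -/
noncomputable def eigenfDual (τ lam α ρ : ℂ) : ℂ → ℂ :=
  block τ (α / 2) (1 + ρ - Complex.I * lam) (2 + α + ρ - Complex.I * lam)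
    (1 + ρ + Complex.I * lam) (α + ρ + Complex.I * lam)

/-- In the total Gaussian exponent the terms in `z ^ 2` cancel and the linear term is `-(α / 2) z`;
the constant is its value at `z = 0`. The equality holds for all `z`, since both sides vanish under
the convention `w / 0 = 0` wherever a denominator does. -/
lemma exists_eigenf_eq {τ : ℂ} (hτ : τ ≠ 0) (lam α ρ : ℂ) :
    ∃ C : ℂ, ∀ z, eigenf τ lam α ρ z = C * eigenfCore τ lam α ρ z := by
  refine ⟨qpow τ (((1 + Complex.I * lam) * (α + ρ - 1 / (2 * τ)) +
    Complex.I * lam * (ρ - 1 / (2 * τ))) / 2), fun z => ?_⟩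
  rw [eigenf, eigenfCore, block,
    show -1 - 1 / (2 * τ) + α + ρ - Complex.I * lam + z =
      (-1 + α + ρ - Complex.I * lam + z) - 1 / (2 * τ) by ring,
    show -(1 / (2 * τ)) + ρ - Complex.I * lam - z =
      (ρ - Complex.I * lam - z) - 1 / (2 * τ) by ring,
    show 1 - 1 / (2 * τ) + α + ρ + Complex.I * lam - z =
      (1 + α + ρ + Complex.I * lam - z) - 1 / (2 * τ) by ring,
    show -(1 / (2 * τ)) + ρ + Complex.I * lam + z =
      (ρ + Complex.I * lam + z) - 1 / (2 * τ) by ring,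
    qGamma_sub_half_period hτ, qGamma_sub_half_period hτ, qGamma_sub_half_period hτ,
    qGamma_sub_half_period hτ,
    show -1 + α + ρ - Complex.I * lam + z + 1 = α + ρ - Complex.I * lam + z by ring,
    show ρ - Complex.I * lam - z + 1 = 1 + ρ - Complex.I * lam - z by ring,
    show 1 + α + ρ + Complex.I * lam - z + 1 = 2 + α + ρ + Complex.I * lam - z by ring,
    show ρ + Complex.I * lam + z + 1 = 1 + ρ + Complex.I * lam + z by ring]
  generalize 1 / (2 * τ) = h
  rw [div_mul_div_comm, div_mul_div_comm, div_div_div_eq, ← qpow_add, ← qpow_add,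
    mul_comm (expPoch τ _ * expPoch τ _) (qpow τ _), mul_div_mul_comm, ← qpow_sub,
    mul_div_assoc (qpow τ _) (_ * _), ← mul_assoc, ← qpow_add]
  congr 2
  ring

/-- For imaginary `τ` conjugation acts on exponents alone, and `conj z = -z` on the imaginary axis;
this replaces the conjugate by a meromorphic function that can be moved off the axis. -/
lemma conj_eigenfCore {τ : ℂ} (hτre : τ.re = 0) (lam : ℝ) (α : ℕ) (ρ : ℝ) {z : ℂ}
    (hz : z.re = 0) :
    conj (eigenfCore τ lam α ρ z) = eigenfDual τ lam α ρ z := by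
  have hz' : conj z = -z := by apply Complex.ext <;> simp [hz]
  simp only [eigenfCore, eigenfDual, block, map_mul, map_div₀, conj_qpow hτre, conj_expPoch hτre,
    map_add, map_sub, map_neg, hz', Complex.conj_I, Complex.conj_ofReal, map_natCast, map_ofNat,
    map_one]
  rw [show -((α : ℂ) / 2) * -z = α / 2 * z by ring,
    show (2 + α + ρ + -Complex.I * lam - -z : ℂ) = 2 + α + ρ - Complex.I * lam + z by ring,
    show (1 + ρ + -Complex.I * lam + -z : ℂ) = 1 + ρ - Complex.I * lam - z by ring,
    show (α + ρ - -Complex.I * lam + -z : ℂ) = α + ρ + Complex.I * lam - z by ring,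
    show (1 + ρ - -Complex.I * lam - -z : ℂ) = 1 + ρ + Complex.I * lam + z by ring,
    mul_comm (expPoch τ (2 + α + ρ - Complex.I * lam + z)),
    mul_comm (expPoch τ (α + ρ + Complex.I * lam - z))]

/-- The pairing integrand without its constant factor. -/
noncomputable def coreIntegrand (τ lam α ρ β σ x z : ℂ) : ℂ :=
  eigenfCore τ lam β σ (1 + x + z) * eigenfDual τ lam α ρ z

lemma div_re_eq_zero {τ : ℂ} (hτre : τ.re = 0) (y : ℝ) : ((y : ℂ) / τ).re = 0 := by
  simp [Complex.div_re, hτre]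

lemma exists_pairingIntegrand_eq {τ : ℂ} (hτre : τ.re = 0) (hτ : τ ≠ 0) (lam : ℝ) (α β : ℕ)
    (ρ σ : ℝ) :
    ∃ C : ℂ, ∀ (x : ℂ) (y : ℝ),
      pairingIntegrand τ (actHat x (actK (eigenf τ lam β σ))) (eigenf τ lam α ρ) y =
        C * coreIntegrand τ lam α ρ β σ x (y / τ) := by
  obtain ⟨C₁, h₁⟩ := exists_eigenf_eq hτ lam β σ
  obtain ⟨C₂, h₂⟩ := exists_eigenf_eq hτ lam α ρ
  refine ⟨C₁ * conj C₂, fun x y => ?_⟩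
  rw [pairingIntegrand, h₂, map_mul, conj_eigenfCore hτre lam α ρ (div_re_eq_zero hτre y), actHat,
    actK, h₁, coreIntegrand, show (y : ℂ) / τ + x + 1 = 1 + x + y / τ by ring]
  ring

/-- For `|Re x| ≤ 2` the argument `1 + x + z` has real part in `[-1, 3]`, and `σ ≥ 3` keeps the
denominator exponents of the first factor in the right half plane. -/
lemma continuous_coreIntegrand {τ : ℂ} (hτre : τ.re = 0) (hτim : 0 < τ.im) (lam : ℝ) (α β : ℕ)
    {ρ σ : ℝ} (hρ : 3 ≤ ρ) (hσ : 3 ≤ σ) {x : ℂ} (hx : |x.re| ≤ 2) :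
    Continuous fun y : ℝ => coreIntegrand τ lam α ρ β σ x (y / τ) := by
  rw [continuous_iff_continuousAt]
  intro y
  have hy := div_re_eq_zero hτre y
  rw [abs_le] at hx
  have hβ : (0 : ℝ) ≤ β := β.cast_nonneg
  have hα : (0 : ℝ) ≤ α := α.cast_nonneg
  have h : DifferentiableAt ℂ (coreIntegrand τ lam α ρ β σ x) (y / τ) := by
    unfold coreIntegrand
    refine DifferentiableAt.mul ?_ ?_
    · refine DifferentiableAt.comp (g := eigenfCore τ lam β σ) (f := fun z => 1 + x + z) _ ?_
        (by fun_prop)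
      refine block_differentiableAt hτre hτim _ _ _ ?_ ?_ <;>
        simp only [Complex.add_re, Complex.sub_re, hy] <;> simp <;> linarith
    · refine block_differentiableAt hτre hτim _ _ _ ?_ ?_ <;>
        simp only [Complex.add_re, Complex.sub_re, hy] <;> simp <;> linarith
  have hc : ContinuousAt (fun y : ℝ => (y : ℂ) / τ) y := by fun_prop
  exact ContinuousAt.comp (f := fun y : ℝ => (y : ℂ) / τ) h.continuousAt hc

/-! ### Translates expressed through common factors -/

/-- The common factor of the translates `eigenfCore (v + 2)`, `eigenfCore v`,
`eigenfCore (v - 2)`. -/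
noncomputable def eigenfBase (τ lam β σ : ℂ) : ℂ → ℂ :=
  block τ (-(β / 2)) (4 + β + σ + Complex.I * lam) (3 + σ + Complex.I * lam)
    (β + σ - 2 - Complex.I * lam) (σ - 1 - Complex.I * lam)

/-- The factor of the telescoped function that comes from `eigenfCore`. -/
noncomputable def teleLeft (τ lam β σ : ℂ) : ℂ → ℂ :=
  block τ (-(β / 2)) (4 + β + σ + Complex.I * lam) (1 + σ + Complex.I * lam)
    (β + σ - 2 - Complex.I * lam) (1 + σ - Complex.I * lam)

/-- The factor of the telescoped function that comes from `eigenfDual`. -/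
noncomputable def teleRight (τ lam α ρ : ℂ) : ℂ → ℂ :=
  block τ (α / 2) (1 + ρ - Complex.I * lam) (α + ρ - Complex.I * lam)
    (1 + ρ + Complex.I * lam) (2 + α + ρ + Complex.I * lam)

section Shifts

variable {τ : ℂ}

lemma eigenfCore_eq_base (hτre : τ.re = 0) (hτim : 0 < τ.im) (lam : ℝ) (α : ℕ) {ρ : ℝ}
    (hρ : 3 ≤ ρ) {v : ℂ} (hv : v.re = 1) :
    eigenfCore τ lam α ρ v =
      (1 - qpow τ (1 + ρ + Complex.I * lam + v)) * (1 - qpow τ (ρ - 1 - Complex.I * lam - v)) *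
        ((1 - qpow τ (2 + α + ρ + Complex.I * lam - v)) *
          (1 - qpow τ (α + ρ - 2 - Complex.I * lam + v))) * eigenfBase τ lam α ρ v := by
  have hα : (0 : ℝ) ≤ α := α.cast_nonneg
  rw [eigenfCore, block_raise₁ hτre hτim, block_raise₂ hτre hτim, block_lower₃ hτre hτim,
    block_lower₄ hτre hτim, eigenfBase]
  · ring_nf
  · simp [hv]; linarith
  · simp [hv]; linarith

lemma eigenfCore_add_two (hτre : τ.re = 0) (hτim : 0 < τ.im) (lam : ℝ) (α : ℕ) {ρ : ℝ}
    (hρ : 3 ≤ ρ) {v : ℂ} (hv : v.re = 1) :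
    eigenfCore τ lam α ρ (v + 2) = qpow τ (-α) *
      (((1 - qpow τ (α + ρ + Complex.I * lam - v)) *
          (1 - qpow τ (α + ρ - Complex.I * lam + v))) *
        ((1 - qpow τ (2 + α + ρ + Complex.I * lam - v)) *
          (1 - qpow τ (α + ρ - 2 - Complex.I * lam + v)))) * eigenfBase τ lam α ρ v := by
  have hα : (0 : ℝ) ≤ α := α.cast_nonneg
  rw [eigenfCore, block_add_two, block_raise₁ hτre hτim, block_raise₁ hτre hτim,
    block_lower₃ hτre hτim, block_lower₃ hτre hτim, eigenfBase]
  · ring_nf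
  · simp [hv]; linarith
  · simp [hv]; linarith

lemma eigenfCore_sub_two (hτre : τ.re = 0) (hτim : 0 < τ.im) (lam : ℝ) (α : ℕ) {ρ : ℝ}
    (hρ : 3 ≤ ρ) {v : ℂ} (hv : v.re = 1) :
    eigenfCore τ lam α ρ (v - 2) = qpow τ α *
      (((1 - qpow τ (ρ - 1 + Complex.I * lam + v)) *
          (1 - qpow τ (1 + ρ - Complex.I * lam - v))) *
        ((1 - qpow τ (1 + ρ + Complex.I * lam + v)) *
          (1 - qpow τ (ρ - 1 - Complex.I * lam - v)))) * eigenfBase τ lam α ρ v := by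
  rw [eigenfCore, block_sub_two, block_raise₂ hτre hτim, block_raise₂ hτre hτim,
    block_lower₄ hτre hτim, block_lower₄ hτre hτim, eigenfBase]
  · ring_nf
  · simp [hv]; linarith
  · simp [hv]; linarith

lemma teleLeft_eq (hτre : τ.re = 0) (hτim : 0 < τ.im) (lam : ℝ) (α : ℕ) {ρ : ℝ}
    (hρ : 3 ≤ ρ) {v : ℂ} (hv : v.re = 1) :
    teleLeft τ lam α ρ v =
      (1 - qpow τ (1 + ρ + Complex.I * lam + v)) * (1 - qpow τ (ρ - 1 - Complex.I * lam - v)) *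
        eigenfBase τ lam α ρ v := by
  rw [teleLeft, block_raise₂ hτre hτim, block_lower₄ hτre hτim, eigenfBase]
  · ring_nf
  · simp [hv]; linarith

lemma teleLeft_add_two (hτre : τ.re = 0) (hτim : 0 < τ.im) (lam : ℝ) (α : ℕ) {ρ : ℝ}
    (hρ : 3 ≤ ρ) {v : ℂ} (hv : v.re = 1) :
    teleLeft τ lam α ρ (v + 2) = qpow τ (-α) *
      ((1 - qpow τ (2 + α + ρ + Complex.I * lam - v)) *
          (1 - qpow τ (α + ρ - 2 - Complex.I * lam + v))) * eigenfBase τ lam α ρ v := by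
  have hα : (0 : ℝ) ≤ α := α.cast_nonneg
  rw [teleLeft, block_add_two, block_raise₁ hτre hτim, block_lower₃ hτre hτim, eigenfBase]
  · ring_nf
  · simp [hv]; linarith

lemma teleRight_eq (hτre : τ.re = 0) (hτim : 0 < τ.im) (lam : ℝ) (α : ℕ) {ρ : ℝ}
    (hρ : 3 ≤ ρ) {z : ℂ} (hz : z.re = 0) :
    teleRight τ lam α ρ z =
      (1 - qpow τ (α + ρ - Complex.I * lam + z)) * (1 - qpow τ (α + ρ + Complex.I * lam - z)) *
        eigenfDual τ lam α ρ z := by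
  have hα : (0 : ℝ) ≤ α := α.cast_nonneg
  rw [teleRight, block_raise₂ hτre hτim, block_lower₄ hτre hτim, eigenfDual]
  · ring_nf
  · simp [hz]; linarith

lemma teleRight_add_two (hτre : τ.re = 0) (hτim : 0 < τ.im) (lam : ℝ) (α : ℕ) {ρ : ℝ}
    (hρ : 3 ≤ ρ) {z : ℂ} (hz : z.re = 0) :
    teleRight τ lam α ρ (z + 2) = qpow τ α *
      ((1 - qpow τ (ρ - 1 - Complex.I * lam - z)) * (1 - qpow τ (1 + ρ + Complex.I * lam + z))) *
        eigenfDual τ lam α ρ z := by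
  rw [teleRight, block_add_two, block_raise₁ hτre hτim, block_lower₃ hτre hτim, eigenfDual]
  · ring_nf
  · simp [hz]; linarith

end Shifts

/-! ### Telescoping of the integrands -/

/-- The function whose difference `G (z + 2) - G z` is the combination of integrands in the
second order difference equation. -/
noncomputable def telescoper (τ lam α ρ β σ x z : ℂ) : ℂ :=
  certificate (qpow τ 1) (qpow τ (Complex.I * lam)) (qpow τ β) (qpow τ σ) (qpow τ α) (qpow τ ρ)
    (qpow τ x) (qpow τ z) * teleRight τ lam α ρ z * teleLeft τ lam β σ (1 + x + z)

section Recurrence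

variable {τ : ℂ}

/-- The telescoping identity for the integrands. -/
lemma coreIntegrand_telescope (hτre : τ.re = 0) (hτim : 0 < τ.im) (lam : ℝ) (α β : ℕ)
    {ρ σ : ℝ} (hρ : 3 ≤ ρ) (hσ : 3 ≤ σ) {a b c d x z : ℂ}
    (ha : a = 1 + ρ + σ) (hb : b = 1 - ρ + σ)
    (hc : c = 1 + α + ρ - β - σ) (hd : d = 1 - α - ρ - β - σ) (hx : x.re = 0) (hz : z.re = 0) :
    upCoeff (qpow τ 1) (qpow τ β) (qpow τ σ) (qpow τ x) (qpow τ a) (qpow τ b) *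
        coreIntegrand τ lam α ρ β σ (x + 2) z +
      midCoeff (qpow τ 1) (qpow τ (Complex.I * lam)) (qpow τ β) (qpow τ x) (qpow τ a) (qpow τ b)
        (qpow τ c) (qpow τ d) * coreIntegrand τ lam α ρ β σ x z +
      downCoeff (qpow τ 1) (qpow τ β) (qpow τ x) (qpow τ c) (qpow τ d) *
        coreIntegrand τ lam α ρ β σ (x - 2) z =
    telescoper τ lam α ρ β σ x (z + 2) - telescoper τ lam α ρ β σ x z := by
  have hv : (1 + x + z).re = 1 := by simp [hx, hz]
  have key := certificate_identity (qpow_ne_zero τ 1) (qpow_ne_zero τ (Complex.I * lam))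
    (qpow_ne_zero τ β) (qpow_ne_zero τ σ) (qpow_ne_zero τ α) (qpow_ne_zero τ ρ)
    (qpow_ne_zero τ x) (qpow_ne_zero τ z)
  have ha' : qpow τ a = qpow τ 1 * qpow τ ρ * qpow τ σ := by simp only [ha, qpow_add]
  have hb' : qpow τ b = qpow τ 1 * qpow τ σ / qpow τ ρ := by
    rw [hb, qpow_add, qpow_sub]; ring
  have hc' : qpow τ c = qpow τ 1 * qpow τ α * qpow τ ρ / (qpow τ β * qpow τ σ) := by
    simp only [hc, qpow_add, qpow_sub]; rw [div_div]
  have hd' : qpow τ d = qpow τ 1 / (qpow τ α * qpow τ ρ * qpow τ β * qpow τ σ) := by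
    simp only [hd, qpow_sub]; simp only [div_div, mul_assoc]
  simp only [coreIntegrand, telescoper]
  rw [show 1 + (x + 2) + z = 1 + x + z + 2 by ring, show 1 + (x - 2) + z = 1 + x + z - 2 by ring,
    show 1 + x + (z + 2) = 1 + x + z + 2 by ring,
    eigenfCore_add_two hτre hτim lam β hσ hv, eigenfCore_eq_base hτre hτim lam β hσ hv,
    eigenfCore_sub_two hτre hτim lam β hσ hv, teleLeft_add_two hτre hτim lam β hσ hv,
    teleLeft_eq hτre hτim lam β hσ hv, teleRight_add_two hτre hτim lam α hρ hz,
    teleRight_eq hτre hτim lam α hρ hz, ha', hb', hc', hd']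
  have e₂ : qpow τ (z + 2) = qpow τ 1 ^ 2 * qpow τ z := by
    rw [qpow_add, qpow_two, mul_comm]
  rw [e₂]
  simp only [qpow_add, qpow_sub, qpow_neg, qpow_two]
  -- Every term now carries the same two transcendental factors; what remains is the rational
  -- identity.
  linear_combination eigenfBase τ lam β σ (1 + x + z) * eigenfDual τ lam α ρ z * key

end Recurrence

/-! ### Integration of the telescoping identity -/

section Integrals

variable {τ : ℂ}

/-- On the strip, `1 + x + z` has real part in `[1, 3]`. The denominator exponents then have real
parts at least `1 + ρ` and `α + ρ` on the right, `β + σ - 1` and `σ - 2` on the left, all positive.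
-/
lemma differentiableAt_telescoper (hτre : τ.re = 0) (hτim : 0 < τ.im) (lam : ℝ) (α β : ℕ)
    {ρ σ : ℝ} (hρ : 3 ≤ ρ) (hσ : 3 ≤ σ) {x z : ℂ} (hx : x.re = 0) (hz₀ : 0 ≤ z.re)
    (hz₂ : z.re ≤ 2) : DifferentiableAt ℂ (telescoper τ lam α ρ β σ x) z := by
  have hα : (0 : ℝ) ≤ α := α.cast_nonneg
  have hβ : (0 : ℝ) ≤ β := β.cast_nonneg
  have hq := differentiable_qpow τ
  have hne : qpow τ x * qpow τ z ≠ 0 := mul_ne_zero (qpow_ne_zero _ _) (qpow_ne_zero _ _)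
  unfold telescoper
  refine (DifferentiableAt.mul ?_ ?_).mul ?_
  · unfold certificate
    fun_prop (disch := assumption)
  · refine block_differentiableAt hτre hτim _ _ _ ?_ ?_ <;> simp <;> linarith
  · refine DifferentiableAt.comp (g := teleLeft τ lam β σ) (f := fun z => 1 + x + z) _ ?_
      (by fun_prop)
    refine block_differentiableAt hτre hτim _ _ _ ?_ ?_ <;> simp [hx] <;> linarith

lemma telescoper_add_inv (hτ : τ ≠ 0) (lam : ℂ) {α β : ℕ} (hα : Even α) (hβ : Even β)
    (ρ σ x z : ℂ) :
    telescoper τ lam α ρ β σ x (z + τ⁻¹) = telescoper τ lam α ρ β σ x z := by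
  rw [telescoper, telescoper, qpow_add_inv hτ, teleRight, ← add_assoc, teleLeft,
    block_add_inv hτ α hα _ _ _ _ _ _ (.inl rfl), block_add_inv hτ β hβ _ _ _ _ _ _ (.inr rfl)]

/-- The second order difference equation of the matrix coefficients, before the gauge
transformation. -/
theorem integral_coreIntegrand_recurrence (hτre : τ.re = 0) (hτim : 0 < τ.im) (lam : ℝ)
    {α β : ℕ} (hα : Even α) (hβ : Even β) {ρ σ : ℝ} (hρ : 3 ≤ ρ) (hσ : 3 ≤ σ) {a b c d x : ℂ}
    (ha : a = 1 + ρ + σ) (hb : b = 1 - ρ + σ)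
    (hc : c = 1 + α + ρ - β - σ) (hd : d = 1 - α - ρ - β - σ) (hx : x.re = 0) :
    upCoeff (qpow τ 1) (qpow τ β) (qpow τ σ) (qpow τ x) (qpow τ a) (qpow τ b) *
        (∫ y in (0 : ℝ)..1, coreIntegrand τ lam α ρ β σ (x + 2) (y / τ)) +
      midCoeff (qpow τ 1) (qpow τ (Complex.I * lam)) (qpow τ β) (qpow τ x) (qpow τ a) (qpow τ b)
        (qpow τ c) (qpow τ d) * (∫ y in (0 : ℝ)..1, coreIntegrand τ lam α ρ β σ x (y / τ)) +
      downCoeff (qpow τ 1) (qpow τ β) (qpow τ x) (qpow τ c) (qpow τ d) *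
        (∫ y in (0 : ℝ)..1, coreIntegrand τ lam α ρ β σ (x - 2) (y / τ)) = 0 := by
  have hτ : τ ≠ 0 := fun h => by simp [h] at hτim
  have hi : ∀ w : ℂ, |w.re| ≤ 2 → IntervalIntegrable
      (fun y : ℝ => coreIntegrand τ lam α ρ β σ w (y / τ)) MeasureTheory.volume 0 1 := fun w hw =>
    (continuous_coreIntegrand hτre hτim lam α β hρ hσ hw).intervalIntegrable _ _
  have hi₁ := hi (x + 2) (by simp [hx])
  have hi₀ := hi x (by simp [hx])
  have hi₂ := hi (x - 2) (by simp [hx])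
  have hG : ∀ r : ℝ, 0 ≤ r → r ≤ 2 → Continuous fun y : ℝ =>
      telescoper τ lam α ρ β σ x (y / τ + r) := by
    intro r hr₀ hr₂
    rw [continuous_iff_continuousAt]
    intro y
    have hre : ((y : ℂ) / τ + r).re = r := by simp [div_re_eq_zero hτre y]
    exact ContinuousAt.comp (f := fun y : ℝ => (y : ℂ) / τ + r)
      (differentiableAt_telescoper hτre hτim lam α β hρ hσ hx (by rw [hre]; exact hr₀)
        (by rw [hre]; exact hr₂)).continuousAt (by fun_prop)
  have hG₂ := (hG 2 (by norm_num) le_rfl).intervalIntegrable (μ := MeasureTheory.volume) 0 1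
  have hG₀ := (hG 0 le_rfl (by norm_num)).intervalIntegrable (μ := MeasureTheory.volume) 0 1
  simp only [Complex.ofReal_zero, add_zero] at hG₀
  -- The shift by `r = 2` matches the step of the telescoping difference.
  have hshift := integral_add_eq_of_periodic hτre hτim (r := 2) (by norm_num)
    (fun z h₀ h₂ => differentiableAt_telescoper hτre hτim lam α β hρ hσ hx h₀ h₂)
    (telescoper_add_inv hτ lam hα hβ ρ σ x)
  rw [← sub_eq_zero, ← intervalIntegral.integral_sub hG₂ hG₀] at hshift
  rw [← hshift, ← intervalIntegral.integral_const_mul, ← intervalIntegral.integral_const_mul,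
    ← intervalIntegral.integral_const_mul,
    ← intervalIntegral.integral_add (hi₁.const_mul _) (hi₀.const_mul _),
    ← intervalIntegral.integral_add ((hi₁.const_mul _).add (hi₀.const_mul _)) (hi₂.const_mul _)]
  refine intervalIntegral.integral_congr fun y _ => ?_
  have h := coreIntegrand_telescope hτre hτim lam α β hρ hσ ha hb hc hd hx
    (div_re_eq_zero hτre y)
  simpa using h

end Integrals

/-! ### The gauge factor: first order equation and regularity -/

section Gauge

variable {τ : ℂ}

/-- The gauge factor `Δ` without its constant factor. -/
noncomputable def gaugeCore (τ κ a b c d x : ℂ) : ℂ :=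
  qpow τ (κ * x) * (expPoch τ (2 - c - x) * expPoch τ (2 - d - x)) /
    (expPoch τ (a - x) * expPoch τ (b - x))

/-- As for `f_λ`, the quadratic Gaussian terms cancel. Here the constant must be nonzero, because
`Δ` is inverted. -/
lemma exists_gaugeΔ_eq (hτ : τ ≠ 0) (a b c d : ℂ) :
    ∃ C : ℂ, C ≠ 0 ∧ ∀ x, gaugeΔ τ a b c d x =
      C * gaugeCore τ ((a + b + c + d - 4) / 4) a b c d x := by
  refine ⟨qpow τ (-((a + c - 2) * (a - c + 2 * (1 / (2 * τ))) +
    (b + d - 2) * (b - d + 2 * (1 / (2 * τ)))) / 8), qpow_ne_zero _ _, fun x => ?_⟩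
  rw [gaugeΔ, gaugeCore,
    show -1 + 1 / (2 * τ) + a - x = (-1 + a - x) + 1 / (2 * τ) by ring,
    show -1 + 1 / (2 * τ) + b - x = (-1 + b - x) + 1 / (2 * τ) by ring,
    show 1 + 1 / (2 * τ) - c - x = (1 - c - x) + 1 / (2 * τ) by ring,
    show 1 + 1 / (2 * τ) - d - x = (1 - d - x) + 1 / (2 * τ) by ring,
    qGamma_add_half_period hτ, qGamma_add_half_period hτ, qGamma_add_half_period hτ,
    qGamma_add_half_period hτ,
    show -1 + a - x + 1 = a - x by ring, show -1 + b - x + 1 = b - x by ring,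
    show 1 - c - x + 1 = 2 - c - x by ring, show 1 - d - x + 1 = 2 - d - x by ring]
  generalize 1 / (2 * τ) = h
  rw [div_mul_div_comm, div_mul_div_comm, div_div_div_eq, ← qpow_add, ← qpow_add,
    mul_comm (expPoch τ _ * expPoch τ _) (qpow τ _), mul_div_mul_comm, ← qpow_sub,
    mul_div_assoc (qpow τ _) (_ * _), ← mul_assoc, ← qpow_add]
  congr 2
  ring

lemma gaugeCore_add_inv (hτ : τ ≠ 0) {κ : ℂ} {n : ℕ} (hn : Even n) (hκ : κ = -(n / 2))
    (a b c d x : ℂ) : gaugeCore τ κ a b c d (x + τ⁻¹) = gaugeCore τ κ a b c d x := by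
  have h : qpow τ (κ * (x + τ⁻¹)) = qpow τ (κ * x) := by
    obtain ⟨k, rfl⟩ := hn
    rw [mul_add, qpow_add, hκ, show -(((k + k : ℕ) : ℂ) / 2) * τ⁻¹ = -(k * τ⁻¹) by push_cast; ring,
      qpow_neg τ (k * τ⁻¹), qpow_nat_mul_inv hτ, inv_one, mul_one]
  simp only [gaugeCore]
  rw [h, ← sub_sub, ← sub_sub, ← sub_sub, ← sub_sub, expPoch_sub_inv hτ, expPoch_sub_inv hτ,
    expPoch_sub_inv hτ, expPoch_sub_inv hτ]

lemma meromorphic_gaugeCore (hτre : τ.re = 0) (hτim : 0 < τ.im) (κ a b c d : ℂ) :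
    Meromorphic (gaugeCore τ κ a b c d) := by
  have hΦ := differentiable_expPoch hτre hτim
  have hq := differentiable_qpow τ
  have hn : Differentiable ℂ fun x =>
      qpow τ (κ * x) * (expPoch τ (2 - c - x) * expPoch τ (2 - d - x)) := by fun_prop
  have hd : Differentiable ℂ fun x => expPoch τ (a - x) * expPoch τ (b - x) := by fun_prop
  exact fun x => (hn.analyticAt x).meromorphicAt.div (hd.analyticAt x).meromorphicAt

lemma analyticAt_gaugeCore (hτre : τ.re = 0) (hτim : 0 < τ.im) (κ c d : ℂ) {a b x : ℂ}
    (ha : expPoch τ (a - x) ≠ 0) (hb : expPoch τ (b - x) ≠ 0) :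
    AnalyticAt ℂ (gaugeCore τ κ a b c d) x := by
  have hΦ := differentiable_expPoch hτre hτim
  have hq := differentiable_qpow τ
  have hn : Differentiable ℂ fun x =>
      qpow τ (κ * x) * (expPoch τ (2 - c - x) * expPoch τ (2 - d - x)) := by fun_prop
  have hd : Differentiable ℂ fun x => expPoch τ (a - x) * expPoch τ (b - x) := by fun_prop
  exact (hn.analyticAt x).div (hd.analyticAt x) (mul_ne_zero ha hb)

lemma gaugeCore_add_two (hτre : τ.re = 0) (hτim : 0 < τ.im) (κ a b c d x : ℂ)
    (ha : qpow τ (a - x - 2) ≠ 1) (hb : qpow τ (b - x - 2) ≠ 1) :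
    gaugeCore τ κ a b c d (x + 2) * ((1 - qpow τ (a - x - 2)) * (1 - qpow τ (b - x - 2))) =
      qpow τ (2 * κ) * ((1 - qpow τ (-c - x)) * (1 - qpow τ (-d - x))) *
        gaugeCore τ κ a b c d x := by
  have ha' := sub_ne_zero.2 ha.symm
  have hb' := sub_ne_zero.2 hb.symm
  simp only [gaugeCore]
  rw [show κ * (x + 2) = 2 * κ + κ * x by ring, qpow_add, ← sub_sub, ← sub_sub, ← sub_sub,
    ← sub_sub, expPoch_eq_mul hτre hτim (2 - c - x - 2), expPoch_eq_mul hτre hτim (2 - d - x - 2),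
    expPoch_eq_mul hτre hτim (a - x - 2), expPoch_eq_mul hτre hτim (b - x - 2),
    sub_add_cancel, sub_add_cancel, sub_add_cancel, sub_add_cancel,
    show 2 - c - x - 2 = -c - x by ring, show 2 - d - x - 2 = -d - x by ring]
  field_simp

/-- For real `r` and imaginary `x`, `q ^ (r - x) = 1` forces `r = 0` by absolute values, and then `q
^ (2x) = 1`. Hence the zeros and poles of `Δ`, whose parameters are real, are avoided at all real
translates of `x`. -/
lemma qpow_sub_ne_one (hτre : τ.re = 0) (hτim : 0 < τ.im) {x : ℂ} (hx : x.re = 0)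
    (hx' : qpow τ (2 * x) ≠ 1) {r : ℂ} (hr : r.im = 0) : qpow τ (r - x) ≠ 1 := fun h => by
  have h₁ := re_eq_zero_of_qpow_eq_one hτre hτim h
  rw [Complex.sub_re, hx, sub_zero] at h₁
  rw [show r = 0 from Complex.ext h₁ hr, zero_sub, qpow_neg, inv_eq_one] at h
  exact hx' (by rw [qpow_ofNat_mul, h, one_pow])

lemma expPoch_sub_ne_zero (hτre : τ.re = 0) (hτim : 0 < τ.im) {x : ℂ} (hx : x.re = 0)
    (hx' : qpow τ (2 * x) ≠ 1) {r : ℂ} (hr : r.im = 0) : expPoch τ (r - x) ≠ 0 := by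
  refine expPoch_ne_zero hτre hτim fun j => ?_
  rw [sub_add_eq_add_sub]
  exact qpow_sub_ne_one hτre hτim hx hx' (by simp [hr])

lemma gaugeCore_regular (hτre : τ.re = 0) (hτim : 0 < τ.im) (κ : ℂ) {a b c d x : ℂ}
    (ha : a.im = 0) (hb : b.im = 0) (hc : c.im = 0) (hd : d.im = 0) (hx : x.re = 0)
    (hx' : qpow τ (2 * x) ≠ 1) {s : ℂ} (hs : s.im = 0) :
    AnalyticAt ℂ (gaugeCore τ κ a b c d) (x + s) ∧ gaugeCore τ κ a b c d (x + s) ≠ 0 := by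
  have h : ∀ r : ℂ, r.im = 0 → expPoch τ (r - (x + s)) ≠ 0 := fun r hr => by
    rw [show r - (x + s) = r - s - x by ring]
    exact expPoch_sub_ne_zero hτre hτim hx hx' (by simp [hr, hs])
  exact ⟨analyticAt_gaugeCore hτre hτim κ c d (h a ha) (h b hb),
    div_ne_zero (mul_ne_zero (qpow_ne_zero _ _) (mul_ne_zero (h _ (by simp [hc]))
      (h _ (by simp [hd])))) (mul_ne_zero (h a ha) (h b hb))⟩

end Gauge

/-! ### Matching with the Askey-Wilson coefficients -/

section Operator

/-- The gauge multiplier trades two factors in `a`, `b` for two in `c`, `d`; then `c d X ^ 2 (1 - 1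
/ (c X)) (1 - 1 / (d X)) = (1 - c X) (1 - d X)`, with `c d` supplied by the prefactor through `hcd`.
-/
lemma upCoeff_mul_eq {q B S X a b c d g g₁ : ℂ} (hq : q ≠ 0) (hB : B ≠ 0) (hS : S ≠ 0)
    (hX : X ≠ 0) (hc : c ≠ 0) (hd : d ≠ 0) (hcd : c * d = q ^ 2 / (B * S) ^ 2)
    (hX₁ : 1 - X ^ 2 ≠ 0) (hX₂ : 1 - q ^ 2 * X ^ 2 ≠ 0)
    (hg : g₁ * ((1 - a / (X * q ^ 2)) * (1 - b / (X * q ^ 2))) =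
      B⁻¹ * ((1 - 1 / (c * X)) * (1 - 1 / (d * X))) * g) :
    upCoeff q B S X a b * g₁ =
      (1 - a * X) * (1 - b * X) * (1 - c * X) * (1 - d * X) /
        ((1 - X ^ 2) * (1 - q ^ 2 * X ^ 2)) *
        ((1 - X ^ 2) * (1 - q ^ 2 * X ^ 2) * (X ^ 2 - q ^ 2)) * g := by
  have h : q ^ 2 = c * d * (B * S) ^ 2 := by rw [hcd]; field_simp
  calc upCoeff q B S X a b * g₁ = q ^ 2 / (B * S ^ 2) * X ^ 2 * (1 - a * X) * (1 - b * X) *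
        (X ^ 2 - q ^ 2) * (g₁ * ((1 - a / (X * q ^ 2)) * (1 - b / (X * q ^ 2)))) := by
        rw [upCoeff]; ring
    _ = c * d * (B * S) ^ 2 / (B * S ^ 2) * X ^ 2 * (1 - a * X) * (1 - b * X) *
        (X ^ 2 - q ^ 2) * (B⁻¹ * ((1 - 1 / (c * X)) * (1 - 1 / (d * X))) * g) := by
        rw [hg, ← h]
    _ = _ := by
        clear hcd hg h
        generalize 1 - q ^ 2 * X ^ 2 = y at hX₂ ⊢
        field_simp
        ring

lemma downCoeff_mul_eq {q B X a b c d g g₂ : ℂ} (hX : X ≠ 0)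
    (hX₁ : 1 - X ^ 2 ≠ 0) (hX₃ : X ^ 2 - q ^ 2 ≠ 0)
    (hg : g * ((1 - a / X) * (1 - b / X)) =
      B⁻¹ * ((1 - q ^ 2 / (c * X)) * (1 - q ^ 2 / (d * X))) * g₂) :
    downCoeff q B X c d * g₂ =
      (1 - a / X) * (1 - b / X) * (1 - c / X) * (1 - d / X) /
        ((1 - 1 / X ^ 2) * (1 - q ^ 2 / X ^ 2)) *
        ((1 - X ^ 2) * (1 - q ^ 2 * X ^ 2) * (X ^ 2 - q ^ 2)) * g := by
  have h₁ : X ^ 2 - 1 ≠ 0 := by rwa [← neg_sub, neg_ne_zero]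
  have h : (1 - 1 / X ^ 2) * (1 - q ^ 2 / X ^ 2) = (X ^ 2 - 1) * (X ^ 2 - q ^ 2) / X ^ 4 := by
    field_simp
  calc downCoeff q B X c d * g₂ = -(1 - c / X) * (1 - d / X) * (X ^ 4 * (1 - q ^ 2 * X ^ 2)) *
        (B⁻¹ * ((1 - q ^ 2 / (c * X)) * (1 - q ^ 2 / (d * X))) * g₂) := by
        rw [downCoeff]; ring
    _ = -(1 - c / X) * (1 - d / X) * (X ^ 4 * (1 - q ^ 2 * X ^ 2)) *
        (g * ((1 - a / X) * (1 - b / X))) := by rw [hg]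
    _ = _ := by
        rw [h]
        field_simp
        ring

variable {τ : ℂ}

lemma coeffA_eq (τ a b c d x : ℂ) : coeffA τ a b c d x =
    (1 - qpow τ a * qpow τ x) * (1 - qpow τ b * qpow τ x) * (1 - qpow τ c * qpow τ x) *
      (1 - qpow τ d * qpow τ x) /
      ((1 - qpow τ x ^ 2) * (1 - qpow τ 1 ^ 2 * qpow τ x ^ 2)) := by
  simp only [coeffA, qpow_add, qpow_ofNat_mul, qpow_two]

lemma coeffA_neg_eq (τ a b c d x : ℂ) : coeffA τ a b c d (-x) =
    (1 - qpow τ a / qpow τ x) * (1 - qpow τ b / qpow τ x) * (1 - qpow τ c / qpow τ x) *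
      (1 - qpow τ d / qpow τ x) /
      ((1 - 1 / qpow τ x ^ 2) * (1 - qpow τ 1 ^ 2 / qpow τ x ^ 2)) := by
  simp only [coeffA_eq, qpow_neg, inv_pow, div_eq_mul_inv, one_mul]

lemma eigenvalE_eq (τ lam β : ℂ) : eigenvalE τ lam β =
    -1 - qpow τ 1 ^ 2 / qpow τ β ^ 2 + qpow τ 1 / qpow τ β *
      (qpow τ (Complex.I * lam) ^ 2 + 1 / qpow τ (Complex.I * lam) ^ 2) := by
  rw [eigenvalE, qpow_neg, mul_assoc, qpow_ofNat_mul, qpow_sub, qpow_sub, qpow_ofNat_mul,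
    qpow_two, one_div]

lemma midCoeff_eq {q L B X a b c d : ℂ} (hX : X ≠ 0)
    (hX₁ : 1 - X ^ 2 ≠ 0) (hX₂ : 1 - q ^ 2 * X ^ 2 ≠ 0) (hX₃ : X ^ 2 - q ^ 2 ≠ 0) :
    midCoeff q L B X a b c d =
      -((1 - a * X) * (1 - b * X) * (1 - c * X) * (1 - d * X) /
          ((1 - X ^ 2) * (1 - q ^ 2 * X ^ 2)) +
        (1 - a / X) * (1 - b / X) * (1 - c / X) * (1 - d / X) /
          ((1 - 1 / X ^ 2) * (1 - q ^ 2 / X ^ 2)) +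
        (-1 - q ^ 2 / B ^ 2 + q / B * (L ^ 2 + 1 / L ^ 2))) *
      ((1 - X ^ 2) * (1 - q ^ 2 * X ^ 2) * (X ^ 2 - q ^ 2)) := by
  have h₁ : X ^ 2 - 1 ≠ 0 := by rwa [← neg_sub, neg_ne_zero]
  have h : (1 - 1 / X ^ 2) * (1 - q ^ 2 / X ^ 2) = (X ^ 2 - 1) * (X ^ 2 - q ^ 2) / X ^ 4 := by
    field_simp
  rw [midCoeff, h]
  generalize -1 - q ^ 2 / B ^ 2 + q / B * (L ^ 2 + 1 / L ^ 2) = e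
  generalize 1 - q ^ 2 * X ^ 2 = y at hX₂ ⊢
  field_simp
  ring

end Operator

end AskeyWilson

/-! ### The main theorem -/

open AskeyWilson in
theorem mainTheorem3 (τ : ℂ) (hτre : τ.re = 0) (hτim : 0 < τ.im)
    (lam : ℝ) (α β : ℕ) (hα : Even α) (hα0 : 0 < α) (hβ : Even β) (hβ0 : 0 < β)
    (ρ σ : ℝ) (hρ : 3 ≤ ρ) (hσ : 3 ≤ σ)
    (a b c d : ℂ) (ha : a = 1 + ρ + σ) (hb : b = 1 - ρ + σ)
    (hc : c = 1 + α + ρ - β - σ) (hd : d = 1 - α - ρ - β - σ)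
    (F : ℂ → ℂ) (hF : ∀ x, F x = (gaugeΔ τ a b c d x)⁻¹ * phi τ lam α ρ β σ x) :
    Meromorphic (gaugeΔ τ a b c d) ∧
    Function.Periodic (gaugeΔ τ a b c d) τ⁻¹ ∧
    (∀ x : ℂ, |x.re| ≤ 2 →
      IntervalIntegrable
        (pairingIntegrand τ (actHat x (actK (eigenf τ lam β σ))) (eigenf τ lam α ρ))
        MeasureTheory.volume 0 1) ∧
    ∀ x : ℂ, x.re = 0 → qpow τ (2 * x) ≠ 1 →
      (∀ t ∈ ({x, x + 2, x - 2} : Set ℂ),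
        AnalyticAt ℂ (gaugeΔ τ a b c d) t ∧ gaugeΔ τ a b c d t ≠ 0) ∧
      opD τ a b c d F x = eigenvalE τ lam β * F x := by
  have hτ : τ ≠ 0 := fun h => by simp [h] at hτim
  obtain ⟨C, hC, hΔ⟩ := exists_gaugeΔ_eq hτ a b c d
  -- The parameters satisfy `a + b + c + d = 4 - 2β`; the exponent `-β / 2` is an integer, whence
  -- the periodicity of `Δ`.
  rw [show (a + b + c + d - 4) / 4 = -((β : ℂ) / 2) by rw [ha, hb, hc, hd]; ring] at hΔ
  have hΔ' : gaugeΔ τ a b c d = fun x => C * gaugeCore τ (-((β : ℂ) / 2)) a b c d x := funext hΔ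
  obtain ⟨K, hK⟩ := exists_pairingIntegrand_eq hτre hτ lam α β ρ σ
  have ha' : a.im = 0 := by simp [ha]
  have hb' : b.im = 0 := by simp [hb]
  have hc' : c.im = 0 := by simp [hc]
  have hd' : d.im = 0 := by simp [hd]
  refine ⟨?_, ?_, ?_, fun x hx hx' => ⟨?_, ?_⟩⟩
  · rw [hΔ']
    exact fun x => (MeromorphicAt.const C x).mul (meromorphic_gaugeCore hτre hτim _ a b c d x)
  · intro x
    rw [hΔ, hΔ, gaugeCore_add_inv hτ hβ rfl]
  · intro x hx
    rw [show pairingIntegrand τ (actHat x (actK (eigenf τ lam β σ))) (eigenf τ lam α ρ) =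
      fun y : ℝ => K * coreIntegrand τ lam α ρ β σ x (y / τ) from funext (hK x)]
    exact (continuous_const.mul
      (continuous_coreIntegrand hτre hτim lam α β hρ hσ hx)).intervalIntegrable _ _
  · have hreg : ∀ s : ℂ, s.im = 0 → AnalyticAt ℂ (gaugeΔ τ a b c d) (x + s) ∧
        gaugeΔ τ a b c d (x + s) ≠ 0 := fun s hs => by
      have h := gaugeCore_regular hτre hτim (-((β : ℂ) / 2)) ha' hb' hc' hd' hx hx' hs
      rw [hΔ']
      exact ⟨analyticAt_const.mul h.1, mul_ne_zero hC h.2⟩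
    rintro t (rfl | rfl | rfl)
    · simpa using hreg 0 rfl
    · exact hreg 2 (by simp)
    · simpa [sub_eq_add_neg] using hreg (-2) (by simp)
  · have hreg : ∀ s : ℂ, s.im = 0 → gaugeCore τ (-((β : ℂ) / 2)) a b c d (x + s) ≠ 0 :=
      fun s hs => (gaugeCore_regular hτre hτim _ ha' hb' hc' hd' hx hx' hs).2
    have hg₀ := hreg 0 rfl
    have hg₁ := hreg 2 (by simp)
    have hg₂ := hreg (-2) (by simp)
    rw [add_zero] at hg₀
    rw [← sub_eq_add_neg] at hg₂
    have hne : ∀ r : ℂ, r.im = 0 → qpow τ (r - x) ≠ 1 := fun r hr =>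
      qpow_sub_ne_one hτre hτim hx hx' hr
    have hφ : ∀ w, phi τ lam α ρ β σ w =
        K * ∫ y in (0 : ℝ)..1, coreIntegrand τ lam α ρ β σ w (y / τ) := fun w => by
      rw [phi, pairing, ← intervalIntegral.integral_const_mul]
      exact intervalIntegral.integral_congr fun y _ => hK w y
    have hrec := integral_coreIntegrand_recurrence hτre hτim lam hα hβ hρ hσ ha hb hc hd hx
    have hX₁ : 1 - qpow τ x ^ 2 ≠ 0 := by
      rw [← qpow_ofNat_mul]; exact sub_ne_zero.2 hx'.symm
    have hX₂ : 1 - qpow τ 1 ^ 2 * qpow τ x ^ 2 ≠ 0 := by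
      rw [← qpow_two, ← qpow_ofNat_mul, ← qpow_add]
      exact sub_ne_zero.2 (qpow_ne_one_of_re_pos hτre hτim (by simp [hx])).symm
    have hX₃ : qpow τ x ^ 2 - qpow τ 1 ^ 2 ≠ 0 := fun h => by
      refine qpow_ne_one_of_re_pos hτre hτim (u := 2 - 2 * x) (by simp [hx]) ?_
      rw [qpow_sub, qpow_ofNat_mul, qpow_two, sub_eq_zero.1 h,
        div_self (pow_ne_zero 2 (qpow_ne_zero _ _))]
    have hκ : qpow τ (2 * -((β : ℂ) / 2)) = (qpow τ β)⁻¹ := by rw [← qpow_neg]; ring_nf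
    have hup := upCoeff_mul_eq (q := qpow τ 1) (B := qpow τ β) (S := qpow τ σ) (X := qpow τ x)
      (a := qpow τ a) (b := qpow τ b) (c := qpow τ c) (d := qpow τ d)
      (g := gaugeCore τ (-((β : ℂ) / 2)) a b c d x)
      (g₁ := gaugeCore τ (-((β : ℂ) / 2)) a b c d (x + 2)) (qpow_ne_zero _ _) (qpow_ne_zero _ _)
      (qpow_ne_zero _ _) (qpow_ne_zero _ _) (qpow_ne_zero _ _) (qpow_ne_zero _ _)
      (by rw [← qpow_add, ← qpow_add, ← qpow_two, ← qpow_ofNat_mul, ← qpow_sub, hc, hd]; ring_nf)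
      hX₁ hX₂ (by
        have h := gaugeCore_add_two hτre hτim (-((β : ℂ) / 2)) a b c d x
          (by rw [sub_right_comm]; exact hne _ (by simp [ha']))
          (by rw [sub_right_comm]; exact hne _ (by simp [hb']))
        simp only [qpow_sub, qpow_neg, qpow_two, hκ] at h
        simpa only [div_eq_mul_inv, mul_inv, one_mul, mul_assoc] using h)
    -- The first order equation of the gauge factor is used at `x - 2`, so that it relates the
    -- values at `x - 2` and `x`.
    have hdown := downCoeff_mul_eq (q := qpow τ 1) (B := qpow τ β) (X := qpow τ x)
      (a := qpow τ a) (b := qpow τ b) (c := qpow τ c) (d := qpow τ d)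
      (g := gaugeCore τ (-((β : ℂ) / 2)) a b c d x)
      (g₂ := gaugeCore τ (-((β : ℂ) / 2)) a b c d (x - 2)) (qpow_ne_zero _ _) hX₁ hX₃ (by
        have h := gaugeCore_add_two hτre hτim (-((β : ℂ) / 2)) a b c d (x - 2)
          (by rw [sub_sub, sub_add_cancel]; exact hne _ ha')
          (by rw [sub_sub, sub_add_cancel]; exact hne _ hb')
        rw [sub_add_cancel, sub_sub, sub_sub, sub_add_cancel, show -c - (x - 2) = 2 - c - x by ring,
          show -d - (x - 2) = 2 - d - x by ring] at h
        simp only [qpow_sub, qpow_two, hκ] at h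
        simpa only [div_div] using h)
    rw [midCoeff_eq (qpow_ne_zero _ _) hX₁ hX₂ hX₃, ← coeffA_eq, ← coeffA_neg_eq,
      ← eigenvalE_eq] at hrec
    rw [← coeffA_eq] at hup
    rw [← coeffA_neg_eq] at hdown
    rw [opD, hF, hF, hF, hΔ, hΔ, hΔ, hφ, hφ, hφ]
    -- `W` is the common denominator cleared from the three coefficients; it is nonzero because `q ^
    -- (2x) ≠ 1` and `Re x = 0`.
    have hW := mul_ne_zero (mul_ne_zero hX₁ hX₂) hX₃
    generalize (1 - qpow τ x ^ 2) * (1 - qpow τ 1 ^ 2 * qpow τ x ^ 2) *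
      (qpow τ x ^ 2 - qpow τ 1 ^ 2) = W at *
    rw [← eq_div_iff hg₁] at hup
    rw [← eq_div_iff hg₂] at hdown
    rw [hup, hdown] at hrec
    generalize (∫ y in (0 : ℝ)..1, coreIntegrand τ lam α ρ β σ (x + 2) (y / τ)) = φ₁ at *
    generalize (∫ y in (0 : ℝ)..1, coreIntegrand τ lam α ρ β σ x (y / τ)) = φ₀ at *
    generalize (∫ y in (0 : ℝ)..1, coreIntegrand τ lam α ρ β σ (x - 2) (y / τ)) = φ₂ at *
    generalize gaugeCore τ (-((β : ℂ) / 2)) a b c d (x + 2) = g₁ at *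
    generalize gaugeCore τ (-((β : ℂ) / 2)) a b c d (x - 2) = g₂ at *
    generalize gaugeCore τ (-((β : ℂ) / 2)) a b c d x = g₀ at *
    generalize coeffA τ a b c d x = A₁ at *
    generalize coeffA τ a b c d (-x) = A₂ at *
    generalize eigenvalE τ lam β = E at *
    -- With `W` and the nonzero gauge values divided out, the recurrence is the eigenvalue equation
    -- up to the constant `K`.
    have h : W * (A₁ * (g₀ / g₁) * φ₁ - (A₁ + A₂ + E) * φ₀ + A₂ * (g₀ / g₂) * φ₂) = 0 := by
      linear_combination hrec
    have h' := (mul_eq_zero.1 h).resolve_left hW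
    field_simp at h' ⊢
    linear_combination K * h'
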